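/- Let $d,k\ge 0$ be integers, let $X_1,\dots,X_k\in M_d(\mathbb C)$ be self-adjoint, and let $\mathcal S_d=\{\rho\in M_d(\mathbb C):\rho\ge 0,\ \operatorname{tr}\rho=1\}$ be the set of states. For $\rho\in\mathcal S_d$ put $S(\rho)=-\operatorname{tr}(\rho\log\rho)$ (natural logarithm, $0\log 0=0$) and $m(\rho)=(\operatorname{tr}(\rho X_1),\dots,\operatorname{tr}(\rho X_k))\in\mathbb R^k$. Let $M_X=\{m(\rho):\rho\in\mathcal S_d\}$, let $m\in\mathbb R^k$, let $C(m)=\{\rho\in\mathcal S_d: m(\rho)=m\}$, and let $\sigma\in C(m)$ be a maximizer of $S$ on $C(m)$. Write $\|A\|_1=\operatorname{tr}\sqrt{A^*A}$ for the trace norm and $\|\cdot\|$ for the Euclidean norm on $\mathbb R^k$. 1. For every $\rho\in C(m)$, $$\|\rho-\sigma\|_1\le\sqrt{2\,(S(\sigma)-S(\rho))}.$$ 2. Assume that $m$ lies in the relative interior of $M_X$. Then $\sigma$ has multipliers, that is, there is $\lambda\in\mathbb R^k$ with $$\sigma=\frac{\exp\left(-\sum_{i=1}^k\lambda_iX_i\right)}{\operatorname{tr}\exp\left(-\sum_{i=1}^k\lambda_iX_i\right)},$$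 and for every such $\lambda$ and every $\rho\in\mathcal S_d$, with $\Delta m=m(\rho)-m$, $$\|\rho-\sigma\|_1\le\sqrt{2\,|S(\sigma)-S(\rho)|}+\sqrt{2\,\|\lambda\|\,\|\Delta m\|}.$$ -/

import Mathlib

namespace MaxEnt

open scoped Matrix ComplexOrder

noncomputable section

/-- The density matrices `𝓢_d`: positive semidefinite complex matrices of trace one. -/
def stateSpace (d : ℕ) : Set (Matrix (Fin d) (Fin d) ℂ) :=
  {ρ | ρ.PosSemidef ∧ ρ.trace = 1}

/-- The von Neumann entropy `S(ρ) = -tr (ρ log ρ)` (natural logarithm). The logarithm is taken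
by functional calculus with `Real.log 0 = 0`, so that `0 log 0 = 0` as usual. -/
def entropy {d : ℕ} (ρ : Matrix (Fin d) (Fin d) ℂ) : ℝ :=
  -(ρ * cfc Real.log ρ).trace.re

/-- The trace norm `‖A‖₁ = tr |A|` with `|A| = (A* A)^{1/2}`. -/
def traceNorm {d : ℕ} (A : Matrix (Fin d) (Fin d) ℂ) : ℝ :=
  (cfc Real.sqrt (Aᴴ * A)).trace.re

/-- The moment vector `m(ρ) = (tr (ρ X₁), …, tr (ρ X_k))`, in `ℝ^k` with the Euclidean norm. The
traces are real when `ρ` and the `X_i` are Hermitian. -/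
def moments {d k : ℕ} (X : Fin k → Matrix (Fin d) (Fin d) ℂ)
    (ρ : Matrix (Fin d) (Fin d) ℂ) : EuclideanSpace ℝ (Fin k) :=
  WithLp.toLp 2 fun i => (ρ * X i).trace.re

/-- The set `M_X` of attainable moment vectors. -/
def momentSet {d k : ℕ} (X : Fin k → Matrix (Fin d) (Fin d) ℂ) :
    Set (EuclideanSpace ℝ (Fin k)) :=
  moments X '' stateSpace d

/-- The constraint set `C(m)`. -/
def constraintSet {d k : ℕ} (X : Fin k → Matrix (Fin d) (Fin d) ℂ)
    (m : EuclideanSpace ℝ (Fin k)) : Set (Matrix (Fin d) (Fin d) ℂ) :=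
  {ρ | ρ ∈ stateSpace d ∧ ∀ i, (ρ * X i).trace = (m i : ℂ)}

/-- `σ` is an entropy maximizer on `C(m)`. -/
def IsEntropyMaximizer {d k : ℕ} (X : Fin k → Matrix (Fin d) (Fin d) ℂ)
    (m : EuclideanSpace ℝ (Fin k)) (σ : Matrix (Fin d) (Fin d) ℂ) : Prop :=
  σ ∈ constraintSet X m ∧ ∀ ρ ∈ constraintSet X m, entropy ρ ≤ entropy σ

/-- The Gibbs state `exp (-∑ lᵢ Xᵢ) / tr (exp (-∑ lᵢ Xᵢ))`. -/
def gibbsState {d k : ℕ} (X : Fin k → Matrix (Fin d) (Fin d) ℂ)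
    (l : EuclideanSpace ℝ (Fin k)) : Matrix (Fin d) (Fin d) ℂ :=
  (NormedSpace.exp (-∑ i, l i • X i)).trace⁻¹ • NormedSpace.exp (-∑ i, l i • X i)

end

end MaxEnt

/-!
The proof rests on the quantum Pinsker inequality `‖ρ - τ‖₁² ≤ 2 D(ρ‖τ)` for states with
`ker τ ⊆ ker ρ`, `sq_re_trace_mul_sub_le`. With `W` the unitary matrix of overlaps between the
eigenbases of `ρ` and `τ`, the relative entropy is
`∑ |Wᵢⱼ|² (aᵢ log aᵢ - aᵢ log bⱼ - aᵢ + bⱼ)`, and `ρ - τ` has the entries `(aᵢ - bⱼ) Wᵢⱼ` in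
the two bases. The scalar inequality
`3 (x - y)² ≤ 2 (x + 2y) (x log x - x log y - x + y)` and Cauchy–Schwarz then give the claim.

For a maximizer `σ` and `ρ ∈ C(m)`, the maximality of `S(σ)` along the segment yields
`D(ρ‖(1 - t) σ + t ρ) ≤ S(σ) - S(ρ)` (`relEntropy_le_of_isEntropyMaximizer`), and Pinsker's
inequality as `t → 0` gives the first estimate, also for singular `σ`.

If `m` is in the relative interior, `C(m)` contains a positive definite state
(`exists_posDef_mem_constraintSet`); the same bound then keeps the determinant of `σ` away from zero
(`posDef_of_isEntropyMaximizer`). At a positive definite `σ` the relative entropy is quadratically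
small, so the first-order condition puts `log σ` into the real span of the identity and the `Xᵢ`
(`exists_eq_gibbsState`). Finally `D(ρ‖σ) = S(σ) - S(ρ) + ⟪l, Δm⟫` for the Gibbs state with
multipliers `l` (`relEntropy_gibbsState`), and Pinsker's inequality gives the second estimate.
-/

namespace MaxEnt

open scoped Matrix ComplexOrder

/-! ### Traces and kernels -/

section
variable {n : Type*} [Fintype n]

/-- The trace of a product of two Hermitian matrices is real. -/
lemma ofReal_re_trace_mul {A B : Matrix n n ℂ} (hA : A.IsHermitian) (hB : B.IsHermitian) :
    ((A * B).trace.re : ℂ) = (A * B).trace := by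
  rw [← Complex.conj_eq_iff_re, ← Complex.star_def, ← Matrix.trace_conjTranspose,
    Matrix.conjTranspose_mul, hA.eq, hB.eq, Matrix.trace_mul_comm]

lemma mulVec_eq_zero_of_add {A B : Matrix n n ℂ} (hA : A.PosSemidef) (hB : B.PosSemidef)
    {v : n → ℂ} (h : (A + B) *ᵥ v = 0) : B *ᵥ v = 0 := by
  rw [← hB.dotProduct_mulVec_zero_iff]
  have h1 : star v ⬝ᵥ (A *ᵥ v) + star v ⬝ᵥ (B *ᵥ v) = 0 := by
    rw [← dotProduct_add, ← Matrix.add_mulVec, h, dotProduct_zero]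
  exact ((add_eq_zero_iff_of_nonneg (hA.dotProduct_mulVec_nonneg v)
    (hB.dotProduct_mulVec_nonneg v)).mp h1).2

end

/-! ### Overlaps of eigenbases and the relative entropy -/

section
variable {n : Type*} [Fintype n] [DecidableEq n]

/-- The matrix of inner products of the eigenvectors of `A` with those of `B`, that is `V_A* V_B`
for the diagonalizing unitaries chosen by `Matrix.IsHermitian.eigenvectorUnitary`. -/
noncomputable def overlap {A B : Matrix n n ℂ} (hA : A.IsHermitian) (hB : B.IsHermitian) :
    Matrix n n ℂ :=
  (hA.eigenvectorUnitary : Matrix n n ℂ)ᴴ * (hB.eigenvectorUnitary : Matrix n n ℂ)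

lemma eigenvectorUnitary_mul_conjTranspose {A : Matrix n n ℂ} (hA : A.IsHermitian) :
    (hA.eigenvectorUnitary : Matrix n n ℂ) * (hA.eigenvectorUnitary : Matrix n n ℂ)ᴴ = 1 :=
  Unitary.coe_mul_star_self hA.eigenvectorUnitary

lemma conjTranspose_mul_eigenvectorUnitary {A : Matrix n n ℂ} (hA : A.IsHermitian) :
    (hA.eigenvectorUnitary : Matrix n n ℂ)ᴴ * (hA.eigenvectorUnitary : Matrix n n ℂ) = 1 :=
  Unitary.coe_star_mul_self hA.eigenvectorUnitary

lemma cfc_eq_mul_diagonal_mul {A : Matrix n n ℂ} (hA : A.IsHermitian) (f : ℝ → ℝ) :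
    cfc f A = (hA.eigenvectorUnitary : Matrix n n ℂ) *
      Matrix.diagonal (fun i => (f (hA.eigenvalues i) : ℂ)) *
        (hA.eigenvectorUnitary : Matrix n n ℂ)ᴴ := by
  rw [hA.cfc_eq, Matrix.IsHermitian.cfc, Unitary.conjStarAlgAut_apply]
  rfl

lemma overlap_mul_conjTranspose {A B : Matrix n n ℂ} (hA : A.IsHermitian) (hB : B.IsHermitian) :
    overlap hA hB * (overlap hA hB)ᴴ = 1 := by
  rw [overlap, Matrix.conjTranspose_mul, Matrix.conjTranspose_conjTranspose, Matrix.mul_assoc,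
    ← Matrix.mul_assoc _ _ (hA.eigenvectorUnitary : Matrix n n ℂ),
    eigenvectorUnitary_mul_conjTranspose, Matrix.one_mul, conjTranspose_mul_eigenvectorUnitary]

lemma sum_norm_sq_row {U : Matrix n n ℂ} (hU : U * Uᴴ = 1) (i : n) :
    ∑ j, ‖U i j‖ ^ 2 = 1 := by
  have h := congrFun (congrFun hU i) i
  simp only [Matrix.mul_apply, Matrix.conjTranspose_apply, Matrix.one_apply_eq, RCLike.star_def,
    Complex.mul_conj', ← Complex.ofReal_pow] at h
  exact_mod_cast h

lemma sum_norm_sq_col {U : Matrix n n ℂ} (hU : U * Uᴴ = 1) (j : n) :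
    ∑ i, ‖U i j‖ ^ 2 = 1 := by
  have h := sum_norm_sq_row (U := Uᴴ) (by simpa using mul_eq_one_comm.mp hU) j
  simpa using h

/-- `tr (f(A) g(B)) = ∑ f(aᵢ) g(bⱼ) |Wᵢⱼ|²`, with `W` the overlap matrix of the two eigenbases. This
turns traces of functions of two noncommuting matrices into scalar double sums. -/
lemma re_trace_cfc_mul_cfc {A B : Matrix n n ℂ} (hA : A.IsHermitian) (hB : B.IsHermitian)
    (f g : ℝ → ℝ) :
    (cfc f A * cfc g B).trace.re =
      ∑ i, ∑ j, ‖overlap hA hB i j‖ ^ 2 * (f (hA.eigenvalues i) * g (hB.eigenvalues j)) := by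
  have h : (cfc f A * cfc g B).trace =
      (Matrix.diagonal (fun i => (f (hA.eigenvalues i) : ℂ)) * overlap hA hB *
        (Matrix.diagonal (fun i => (g (hB.eigenvalues i) : ℂ)) * (overlap hA hB)ᴴ)).trace := by
    rw [cfc_eq_mul_diagonal_mul hA, cfc_eq_mul_diagonal_mul hB, overlap, Matrix.conjTranspose_mul,
      Matrix.conjTranspose_conjTranspose, Matrix.mul_assoc, Matrix.mul_assoc, Matrix.trace_mul_comm]
    simp only [Matrix.mul_assoc]
  rw [h, Matrix.trace, Complex.re_sum]
  refine Finset.sum_congr rfl fun i _ => ?_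
  rw [Matrix.diag_apply, Matrix.mul_apply, Complex.re_sum]
  refine Finset.sum_congr rfl fun j _ => ?_
  rw [Matrix.diagonal_mul, Matrix.diagonal_mul, Matrix.conjTranspose_apply, RCLike.star_def,
    show ∀ a w b : ℂ, a * w * (b * (starRingEnd ℂ) w) = (a * b) * (w * (starRingEnd ℂ) w) by
      intros; ring, Complex.mul_conj']
  norm_cast
  ring

/-- The spectrum of a matrix is finite, so that the functional calculus accepts every function. -/
lemma continuousOn_spectrum (f : ℝ → ℝ) (A : Matrix n n ℂ) : ContinuousOn f (spectrum ℝ A) :=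
  Matrix.finite_real_spectrum.continuousOn f

lemma mul_cfc {A : Matrix n n ℂ} (hA : A.IsHermitian) (f : ℝ → ℝ) :
    A * cfc f A = cfc (fun x => x * f x) A := by
  have hA' : IsSelfAdjoint A := hA
  rw [cfc_mul (fun x => x) f A (continuousOn_spectrum _ _) (continuousOn_spectrum _ _), cfc_id' ℝ A]

/-- The relative entropy `D(A‖B) = tr (A (log A - log B))`. Since `Real.log 0 = 0`, this is the
usual relative entropy only when `ker B ⊆ ker A`; otherwise the usual one is `+∞`. -/
noncomputable def relEntropy (A B : Matrix n n ℂ) : ℝ :=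
  (A * cfc Real.log A).trace.re - (A * cfc Real.log B).trace.re

lemma relEntropy_eq_sum {A B : Matrix n n ℂ} (hA : A.IsHermitian) (hB : B.IsHermitian) :
    relEntropy A B - A.trace.re + B.trace.re =
      ∑ i, ∑ j, ‖overlap hA hB i j‖ ^ 2 *
        (hA.eigenvalues i * Real.log (hA.eigenvalues i) -
          hA.eigenvalues i * Real.log (hB.eigenvalues j) - hA.eigenvalues i +
            hB.eigenvalues j) := by
  have hA' : IsSelfAdjoint A := hA
  have hB' : IsSelfAdjoint B := hB
  have h1 := re_trace_cfc_mul_cfc hA hB (fun x => x * Real.log x) (fun _ => 1)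
  have h2 := re_trace_cfc_mul_cfc hA hB (fun x => x) Real.log
  have h3 := re_trace_cfc_mul_cfc hA hB (fun x => x) (fun _ => 1)
  have h4 := re_trace_cfc_mul_cfc hA hB (fun _ => 1) (fun x => x)
  rw [cfc_const_one ℝ B, Matrix.mul_one, ← mul_cfc hA] at h1
  rw [cfc_id' ℝ A] at h2
  rw [cfc_const_one ℝ B, Matrix.mul_one, cfc_id' ℝ A] at h3
  rw [cfc_const_one ℝ A, Matrix.one_mul, cfc_id' ℝ B] at h4
  rw [relEntropy, h1, h2, h3, h4]
  simp only [← Finset.sum_sub_distrib, ← Finset.sum_add_distrib]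
  refine Finset.sum_congr rfl fun i _ => Finset.sum_congr rfl fun j _ => ?_
  ring

/-- In the pair of eigenbases, the entries of `A - B` are `(aᵢ - bⱼ) Wᵢⱼ`. -/
lemma conj_sub_apply {A B : Matrix n n ℂ} (hA : A.IsHermitian) (hB : B.IsHermitian) (i j : n) :
    ((hA.eigenvectorUnitary : Matrix n n ℂ)ᴴ * (A - B) * (hB.eigenvectorUnitary : Matrix n n ℂ)) i j
      = ((hA.eigenvalues i - hB.eigenvalues j : ℝ) : ℂ) * overlap hA hB i j := by
  have hA' : IsSelfAdjoint A := hA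
  have hB' : IsSelfAdjoint B := hB
  have h1 := cfc_eq_mul_diagonal_mul hA (fun x => x)
  have h2 := cfc_eq_mul_diagonal_mul hB (fun x => x)
  rw [cfc_id' ℝ A] at h1
  rw [cfc_id' ℝ B] at h2
  have h3 : (hA.eigenvectorUnitary : Matrix n n ℂ)ᴴ * A =
      Matrix.diagonal (fun i => (hA.eigenvalues i : ℂ)) *
        (hA.eigenvectorUnitary : Matrix n n ℂ)ᴴ := by
    refine (congrArg ((hA.eigenvectorUnitary : Matrix n n ℂ)ᴴ * ·) h1).trans ?_
    rw [Matrix.mul_assoc, ← Matrix.mul_assoc, conjTranspose_mul_eigenvectorUnitary, Matrix.one_mul]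
  have h4 : B * (hB.eigenvectorUnitary : Matrix n n ℂ) = (hB.eigenvectorUnitary : Matrix n n ℂ) *
      Matrix.diagonal (fun i => (hB.eigenvalues i : ℂ)) := by
    refine (congrArg (· * (hB.eigenvectorUnitary : Matrix n n ℂ)) h2).trans ?_
    rw [Matrix.mul_assoc, conjTranspose_mul_eigenvectorUnitary, Matrix.mul_one]
  rw [Matrix.mul_sub, Matrix.sub_mul, h3, Matrix.mul_assoc, Matrix.mul_assoc _ B, h4,
    ← Matrix.mul_assoc _ _ (Matrix.diagonal _), Matrix.sub_apply, Matrix.diagonal_mul,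
    Matrix.mul_diagonal, overlap]
  push_cast
  ring

lemma eigenvalue_mul_overlap_eq_zero {A B : Matrix n n ℂ} (hA : A.IsHermitian)
    (hB : B.IsHermitian) (h : ∀ v, B *ᵥ v = 0 → A *ᵥ v = 0) {i j : n}
    (hj : hB.eigenvalues j = 0) : (hA.eigenvalues i : ℂ) * overlap hA hB i j = 0 := by
  have h0 : B *ᵥ ⇑(hB.eigenvectorBasis j) = 0 := by
    rw [hB.mulVec_eigenvectorBasis, hj, zero_smul]
  have h1 : (A - B) *ᵥ ⇑(hB.eigenvectorBasis j) = 0 := by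
    rw [Matrix.sub_mulVec, h0, h _ h0, sub_zero]
  have h2 := conj_sub_apply hA hB i j
  rw [hj, sub_zero, Matrix.mul_assoc, Matrix.mul_apply] at h2
  rw [← h2]
  refine Finset.sum_eq_zero fun l _ => ?_
  have : ((A - B) * (hB.eigenvectorUnitary : Matrix n n ℂ)) l j = 0 := congrFun h1 l
  rw [this, mul_zero]

end

/-! ### Scalar inequalities -/

lemma sqrt_add_le {x y : ℝ} (hx : 0 ≤ x) (hy : 0 ≤ y) : √(x + y) ≤ √x + √y := by
  refine Real.sqrt_le_iff.mpr ⟨by positivity, ?_⟩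
  rw [add_sq, Real.sq_sqrt hx, Real.sq_sqrt hy]
  have := mul_nonneg (Real.sqrt_nonneg x) (Real.sqrt_nonneg y)
  linarith

/-- The scalar inequality behind Pinsker's. After division by `t`, it bounds `log t` below by a
rational function; the difference vanishes at `1` and has derivative `(t - 1)³ / (t² (t + 2)²)`. -/
lemma three_mul_sub_one_sq_le {t : ℝ} (ht : 0 < t) :
    3 * (t - 1) ^ 2 ≤ 2 * (t + 2) * (t * Real.log t - t + 1) := by
  have key : 0 ≤ Real.log t - (5 * t ^ 2 - 4 * t - 1) / (2 * t ^ 2 + 4 * t) := by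
    set h : ℝ → ℝ := fun s => Real.log s - (5 * s ^ 2 - 4 * s - 1) / (2 * s ^ 2 + 4 * s) with hh
    have hder : ∀ s : ℝ, 0 < s → HasDerivAt h ((s - 1) ^ 3 / (s ^ 2 * (s + 2) ^ 2)) s := by
      intro s hs
      have hden : 2 * s ^ 2 + 4 * s ≠ 0 := by positivity
      have h1 : HasDerivAt h _ s := (Real.hasDerivAt_log hs.ne').sub
        (((((hasDerivAt_pow 2 s).const_mul 5).sub ((hasDerivAt_id s).const_mul 4)).sub_const 1).div
          (((hasDerivAt_pow 2 s).const_mul 2).add ((hasDerivAt_id s).const_mul 4)) hden)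
      refine h1.congr_deriv ?_
      simp only [id, Pi.sub_apply, Nat.cast_ofNat, Nat.reduceSub, pow_one]
      field_simp
      ring
    have hcont : ∀ D : Set ℝ, D ⊆ Set.Ioi 0 → ContinuousOn h D := fun D hD s hs =>
      (hder s (hD hs)).continuousAt.continuousWithinAt
    have h1 : h 1 = 0 := by simp only [hh, Real.log_one]; norm_num
    change 0 ≤ h t
    rw [← h1]
    rcases le_total t 1 with htl | htl
    · have : AntitoneOn h (Set.Icc t 1) := by
        refine antitoneOn_of_deriv_nonpos (convex_Icc _ _)
          (hcont _ fun s hs => lt_of_lt_of_le ht hs.1) ?_ ?_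
        · intro s hs
          rw [interior_Icc] at hs
          exact (hder s (ht.trans hs.1)).differentiableAt.differentiableWithinAt
        · intro s hs
          rw [interior_Icc] at hs
          rw [(hder s (ht.trans hs.1)).deriv]
          refine div_nonpos_of_nonpos_of_nonneg ?_ (by positivity)
          exact (Odd.pow_nonpos_iff (by decide)).mpr (by linarith [hs.2])
      exact this ⟨le_rfl, htl⟩ ⟨htl, le_rfl⟩ htl
    · have : MonotoneOn h (Set.Icc 1 t) := by
        refine monotoneOn_of_deriv_nonneg (convex_Icc _ _)
          (hcont _ fun s hs => lt_of_lt_of_le one_pos hs.1) ?_ ?_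
        · intro s hs
          rw [interior_Icc] at hs
          exact (hder s (one_pos.trans hs.1)).differentiableAt.differentiableWithinAt
        · intro s hs
          rw [interior_Icc] at hs
          rw [(hder s (one_pos.trans hs.1)).deriv]
          exact div_nonneg (pow_nonneg (by linarith [hs.1]) 3) (by positivity)
      exact this ⟨le_rfl, htl⟩ ⟨htl, le_rfl⟩ htl
  rw [sub_nonneg, div_le_iff₀ (by positivity)] at key
  nlinarith

lemma three_mul_sub_sq_le {x y : ℝ} (hx : 0 ≤ x) (hy : 0 < y) :
    3 * (x - y) ^ 2 ≤ 2 * (x + 2 * y) * (x * Real.log x - x * Real.log y - x + y) := by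
  rcases hx.eq_or_lt with rfl | hx
  · simp only [zero_mul]
    nlinarith [sq_nonneg y]
  · have h := three_mul_sub_one_sq_le (div_pos hx hy)
    rw [Real.log_div hx.ne' hy.ne'] at h
    have e1 : 3 * (x - y) ^ 2 = y ^ 2 * (3 * (x / y - 1) ^ 2) := by field_simp
    have e2 : 2 * (x + 2 * y) * (x * Real.log x - x * Real.log y - x + y) =
        y ^ 2 * (2 * (x / y + 2) * (x / y * (Real.log x - Real.log y) - x / y + 1)) := by
      field_simp
    rw [e1, e2]
    exact mul_le_mul_of_nonneg_left h (sq_nonneg y)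

lemma mul_log_sub_nonneg {x y : ℝ} (hx : 0 ≤ x) (hy : 0 < y) :
    0 ≤ x * Real.log x - x * Real.log y - x + y := by
  have h := three_mul_sub_sq_le hx hy
  by_contra! hneg
  have : 2 * (x + 2 * y) * (x * Real.log x - x * Real.log y - x + y) < 0 :=
    mul_neg_of_pos_of_neg (by positivity) hneg
  nlinarith [sq_nonneg (x - y)]

lemma mul_log_sub_le {x y : ℝ} (hx : 0 ≤ x) (hy : 0 < y) :
    x * Real.log x - x * Real.log y - x + y ≤ (x - y) ^ 2 / y := by
  rw [le_div_iff₀ hy]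
  rcases hx.eq_or_lt with rfl | hx
  · simp only [zero_mul]; nlinarith
  · have h := Real.log_le_sub_one_of_pos (div_pos hx hy)
    rw [Real.log_div hx.ne' hy.ne', ← sub_nonneg] at h
    have e : (x - y) ^ 2 - (x * Real.log x - x * Real.log y - x + y) * y =
        x * y * (x / y - 1 - (Real.log x - Real.log y)) := by
      field_simp; ring
    have := mul_nonneg (mul_pos hx hy).le h
    linarith

/-! ### Bounds on the relative entropy -/

section
variable {n : Type*} [Fintype n] [DecidableEq n]

/-- The kernel condition lets the scalar inequalities survive `bⱼ = 0`, where `Real.log 0 = 0` would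
break them: then `aᵢ = 0` or the overlap vanishes. -/
theorem overlap_summand_bounds {A B : Matrix n n ℂ} (hA : A.PosSemidef) (hB : B.PosSemidef)
    (hker : ∀ v, B *ᵥ v = 0 → A *ᵥ v = 0) (i j : n) :
    3 * (‖overlap hA.1 hB.1 i j‖ ^ 2 * (hA.1.eigenvalues i - hB.1.eigenvalues j) ^ 2) ≤
      2 * (hA.1.eigenvalues i + 2 * hB.1.eigenvalues j) * (‖overlap hA.1 hB.1 i j‖ ^ 2 *
        (hA.1.eigenvalues i * Real.log (hA.1.eigenvalues i) -
          hA.1.eigenvalues i * Real.log (hB.1.eigenvalues j) - hA.1.eigenvalues i +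
            hB.1.eigenvalues j)) ∧
    0 ≤ ‖overlap hA.1 hB.1 i j‖ ^ 2 *
        (hA.1.eigenvalues i * Real.log (hA.1.eigenvalues i) -
          hA.1.eigenvalues i * Real.log (hB.1.eigenvalues j) - hA.1.eigenvalues i +
            hB.1.eigenvalues j) := by
  rcases (hB.eigenvalues_nonneg j).eq_or_lt with h0 | hpos
  · have h := eigenvalue_mul_overlap_eq_zero hA.1 hB.1 hker (i := i) h0.symm
    rcases mul_eq_zero.mp h with h | h
    · rw [Complex.ofReal_eq_zero] at h
      simp [h, ← h0]
    · simp [h]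
  · constructor
    · have h := mul_le_mul_of_nonneg_left (three_mul_sub_sq_le (hA.eigenvalues_nonneg i) hpos)
        (sq_nonneg ‖overlap hA.1 hB.1 i j‖)
      linarith
    · exact mul_nonneg (sq_nonneg _) (mul_log_sub_nonneg (hA.eigenvalues_nonneg i) hpos)

theorem relEntropy_nonneg {A B : Matrix n n ℂ} (hA : A.PosSemidef) (hB : B.PosSemidef)
    (htr : A.trace = B.trace) (hker : ∀ v, B *ᵥ v = 0 → A *ᵥ v = 0) : 0 ≤ relEntropy A B := by
  have h := relEntropy_eq_sum hA.1 hB.1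
  rw [htr, sub_add_cancel] at h
  rw [h]
  exact Finset.sum_nonneg fun i _ => Finset.sum_nonneg fun j _ =>
    (overlap_summand_bounds hA hB hker i j).2

lemma re_trace_eq_sum_eigenvalues {A : Matrix n n ℂ} (hA : A.IsHermitian) :
    A.trace.re = ∑ i, hA.eigenvalues i := by
  rw [hA.trace_eq_sum_eigenvalues, ← Complex.ofReal_re (∑ i, hA.eigenvalues i)]
  push_cast
  rfl

/-- The quantum Pinsker inequality, tested against a unitary `U`. Expanding `tr (U (A - B))` in the
two eigenbases gives `∑ Yⱼᵢ (aᵢ - bⱼ) Wᵢⱼ` with `Y` unitary; Cauchy–Schwarz with the weights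
`(2/3) (aᵢ + 2 bⱼ)`, which sum to `2` against `|Yⱼᵢ|²`, and the scalar inequality
`overlap_summand_bounds` conclude. No monotonicity of the relative entropy is needed. -/
theorem sq_re_trace_mul_sub_le {A B U : Matrix n n ℂ} (hA : A.PosSemidef) (hB : B.PosSemidef)
    (hAt : A.trace = 1) (hBt : B.trace = 1) (hker : ∀ v, B *ᵥ v = 0 → A *ᵥ v = 0)
    (hU : U * Uᴴ = 1) : (U * (A - B)).trace.re ^ 2 ≤ 2 * relEntropy A B := by
  set a := hA.1.eigenvalues with ha
  set b := hB.1.eigenvalues with hb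
  set V := (hA.1.eigenvectorUnitary : Matrix n n ℂ) with hV
  set V' := (hB.1.eigenvectorUnitary : Matrix n n ℂ) with hV'
  set Y : Matrix n n ℂ := V'ᴴ * U * V with hY
  have hVV : V * Vᴴ = 1 := eigenvectorUnitary_mul_conjTranspose hA.1
  have hVV' : V' * V'ᴴ = 1 := eigenvectorUnitary_mul_conjTranspose hB.1
  have hYY : Y * Yᴴ = 1 := by
    have h : Y * Yᴴ = V'ᴴ * (U * (V * Vᴴ) * Uᴴ) * V' := by
      simp only [hY, Matrix.conjTranspose_mul, Matrix.conjTranspose_conjTranspose, Matrix.mul_assoc]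
    rw [h, hVV, Matrix.mul_one, hU, Matrix.mul_one]
    exact conjTranspose_mul_eigenvectorUnitary hB.1
  have htr : (U * (A - B)).trace = (Y * (Vᴴ * (A - B) * V')).trace := by
    have h : Y * (Vᴴ * (A - B) * V') = V'ᴴ * (U * (V * Vᴴ) * (A - B) * V') := by
      simp only [hY, Matrix.mul_assoc]
    rw [h, hVV, Matrix.mul_one, Matrix.trace_mul_comm V'ᴴ, Matrix.mul_assoc, hVV', Matrix.mul_one]
  have hsum : (U * (A - B)).trace.re =
      ∑ p : n × n, (Y p.2 p.1 * (((a p.1 - b p.2 : ℝ) : ℂ) * overlap hA.1 hB.1 p.1 p.2)).re := by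
    rw [htr, Matrix.trace_mul_comm, Matrix.trace, Complex.re_sum, Fintype.sum_prod_type]
    refine Finset.sum_congr rfl fun i _ => ?_
    rw [Matrix.diag_apply, Matrix.mul_apply, Complex.re_sum]
    refine Finset.sum_congr rfl fun j _ => ?_
    rw [conj_sub_apply hA.1 hB.1 i j, mul_comm]
  have hD := relEntropy_eq_sum hA.1 hB.1
  rw [hAt, hBt, sub_add_cancel, ← Fintype.sum_prod_type'] at hD
  have hat : ∑ i, a i = 1 := by rw [← re_trace_eq_sum_eigenvalues hA.1, hAt, Complex.one_re]
  have hbt : ∑ i, b i = 1 := by rw [← re_trace_eq_sum_eigenvalues hB.1, hBt, Complex.one_re]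
  have ha0 : ∀ i, 0 ≤ a i := hA.eigenvalues_nonneg
  have hb0 : ∀ i, 0 ≤ b i := hB.eigenvalues_nonneg
  -- The weighted sum is `2`, since both traces are `1` and `|Yⱼᵢ|²` is
  -- doubly stochastic.
  have hweight : ∑ p : n × n, ‖Y p.2 p.1‖ ^ 2 * ((a p.1 + 2 * b p.2) * (2 / 3)) = 2 := by
    have h1 : ∑ p : n × n, ‖Y p.2 p.1‖ ^ 2 * a p.1 = 1 := by
      rw [Fintype.sum_prod_type, ← hat]
      refine Finset.sum_congr rfl fun i _ => ?_
      simp only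
      rw [← Finset.sum_mul, sum_norm_sq_col hYY, one_mul]
    have h2 : ∑ p : n × n, ‖Y p.2 p.1‖ ^ 2 * b p.2 = 1 := by
      rw [Fintype.sum_prod_type_right, ← hbt]
      refine Finset.sum_congr rfl fun i _ => ?_
      simp only
      rw [← Finset.sum_mul, sum_norm_sq_row hYY, one_mul]
    calc _ = (2 / 3) * ∑ p : n × n, ‖Y p.2 p.1‖ ^ 2 * a p.1 +
          (4 / 3) * ∑ p : n × n, ‖Y p.2 p.1‖ ^ 2 * b p.2 := by
          rw [Finset.mul_sum, Finset.mul_sum, ← Finset.sum_add_distrib]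
          exact Finset.sum_congr rfl fun p _ => by ring
      _ = 2 := by rw [h1, h2]; norm_num
  rw [hD, ← hweight, hsum]
  refine Finset.sum_sq_le_sum_mul_sum_of_sq_le_mul _ (fun p _ => ?_) (fun p _ => ?_) fun p _ => ?_
  · have := ha0 p.1
    have := hb0 p.2
    positivity
  · exact (overlap_summand_bounds hA hB hker p.1 p.2).2
  · have h1 := (overlap_summand_bounds hA hB hker p.1 p.2).1
    have h2 : (Y p.2 p.1 * (((a p.1 - b p.2 : ℝ) : ℂ) * overlap hA.1 hB.1 p.1 p.2)).re ^ 2 ≤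
        ‖Y p.2 p.1‖ ^ 2 * (‖overlap hA.1 hB.1 p.1 p.2‖ ^ 2 * (a p.1 - b p.2) ^ 2) := by
      refine (sq_le_sq.mpr ((Complex.abs_re_le_norm _).trans (le_abs_self _))).trans (le_of_eq ?_)
      rw [norm_mul, norm_mul, Complex.norm_real, mul_pow, mul_pow, Real.norm_eq_abs, sq_abs]
      ring
    have h3 := mul_le_mul_of_nonneg_left h1 (sq_nonneg ‖Y p.2 p.1‖)
    linarith

/-- At a positive definite `B` the relative entropy is at most quadratic in `A - B`: it is bounded
by a multiple of the squared Hilbert–Schmidt norm. -/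
theorem exists_relEntropy_le {B : Matrix n n ℂ} (hB : B.PosDef) :
    ∃ C : ℝ, ∀ A : Matrix n n ℂ, A.PosSemidef → A.trace = B.trace →
      relEntropy A B ≤ C * ((A - B) * (A - B)).trace.re := by
  refine ⟨∑ j, (hB.1.eigenvalues j)⁻¹, fun A hA htr => ?_⟩
  have hD := relEntropy_eq_sum hA.1 hB.1
  rw [htr, sub_add_cancel] at hD
  have hA' : IsSelfAdjoint A := hA.1
  have hB' : IsSelfAdjoint B := hB.1
  have h1 := re_trace_cfc_mul_cfc hA.1 hB.1 (fun x => x * x) (fun _ => 1)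
  have h2 := re_trace_cfc_mul_cfc hA.1 hB.1 (fun x => x) (fun x => x)
  have h3 := re_trace_cfc_mul_cfc hA.1 hB.1 (fun _ => 1) (fun x => x * x)
  rw [cfc_const_one ℝ B, Matrix.mul_one, ← mul_cfc hA.1, cfc_id' ℝ A] at h1
  rw [cfc_id' ℝ A, cfc_id' ℝ B] at h2
  rw [cfc_const_one ℝ A, Matrix.one_mul, ← mul_cfc hB.1, cfc_id' ℝ B] at h3
  have h4 : ((A - B) * (A - B)).trace.re =
      (A * A).trace.re - 2 * (A * B).trace.re + (B * B).trace.re := by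
    rw [Matrix.sub_mul, Matrix.mul_sub, Matrix.mul_sub]
    simp only [Matrix.trace_sub, Complex.sub_re, Matrix.trace_mul_comm B A]
    ring
  rw [hD, h4, h1, h2, h3]
  simp only [Finset.mul_sum, ← Finset.sum_sub_distrib, ← Finset.sum_add_distrib]
  refine Finset.sum_le_sum fun i _ => Finset.sum_le_sum fun j _ => ?_
  have hb := hB.eigenvalues_pos
  have h5 := mul_log_sub_le (hA.eigenvalues_nonneg i) (hb j)
  have h6 : (hB.1.eigenvalues j)⁻¹ ≤ ∑ j, (hB.1.eigenvalues j)⁻¹ :=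
    Finset.single_le_sum (f := fun j => (hB.1.eigenvalues j)⁻¹)
      (fun j _ => (inv_pos.mpr (hb j)).le) (Finset.mem_univ j)
  have h7 : (hA.1.eigenvalues i - hB.1.eigenvalues j) ^ 2 / hB.1.eigenvalues j ≤
      (∑ j, (hB.1.eigenvalues j)⁻¹) * (hA.1.eigenvalues i - hB.1.eigenvalues j) ^ 2 := by
    rw [div_eq_inv_mul]
    exact mul_le_mul_of_nonneg_right h6 (sq_nonneg _)
  have h8 := mul_le_mul_of_nonneg_left (h5.trans h7) (sq_nonneg ‖overlap hA.1 hB.1 i j‖)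
  linarith

/-- If `A ≥ c`, then `tr (A log B) ≤ c log det B` for a state `B`, because `log B ≤ 0`. -/
theorem re_trace_mul_log_le_mul_log_det {A B : Matrix n n ℂ} (hA : A.IsHermitian) (hB : B.PosDef)
    (hBt : B.trace = 1) {c : ℝ} (hc : ∀ i, c ≤ hA.eigenvalues i) :
    (A * cfc Real.log B).trace.re ≤ c * Real.log B.det.re := by
  have hA' : IsSelfAdjoint A := hA
  have h2 := re_trace_cfc_mul_cfc hA hB.1 (fun x => x) Real.log
  rw [cfc_id' ℝ A] at h2
  have hdet : B.det.re = ∏ j, hB.1.eigenvalues j := by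
    rw [hB.1.det_eq_prod_eigenvalues]
    exact_mod_cast Complex.ofReal_re _
  have hbt : ∑ i, hB.1.eigenvalues i = 1 := by
    rw [← re_trace_eq_sum_eigenvalues hB.1, hBt, Complex.one_re]
  rw [h2, hdet, Real.log_prod (fun j _ => (hB.eigenvalues_pos j).ne'), Finset.mul_sum,
    Finset.sum_comm]
  refine Finset.sum_le_sum fun j _ => ?_
  have hlog : Real.log (hB.1.eigenvalues j) ≤ 0 := by
    refine Real.log_nonpos (hB.eigenvalues_pos j).le ?_
    rw [← hbt]
    exact Finset.single_le_sum (f := hB.1.eigenvalues) (fun j _ => (hB.eigenvalues_pos j).le)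
      (Finset.mem_univ j)
  calc _ ≤ ∑ i, ‖overlap hA hB.1 i j‖ ^ 2 * (c * Real.log (hB.1.eigenvalues j)) :=
        Finset.sum_le_sum fun i _ => mul_le_mul_of_nonneg_left
          (mul_le_mul_of_nonpos_right (hc i) hlog) (sq_nonneg _)
    _ = _ := by
      rw [← Finset.sum_mul, sum_norm_sq_col (overlap_mul_conjTranspose hA hB.1), one_mul]

end

/-- The trace norm of a Hermitian matrix is attained at a unitary, namely at its sign. -/
theorem exists_traceNorm_eq {d : ℕ} {D : Matrix (Fin d) (Fin d) ℂ} (hD : D.IsHermitian) :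
    ∃ U : Matrix (Fin d) (Fin d) ℂ, U * Uᴴ = 1 ∧ traceNorm D = (U * D).trace.re := by
  have hD' : IsSelfAdjoint D := hD
  set s : ℝ → ℝ := fun x => if 0 ≤ x then 1 else -1
  have hs : (cfc s D)ᴴ = cfc s D := (cfc_predicate s D : IsSelfAdjoint _)
  have hcont : ∀ f : ℝ → ℝ, ContinuousOn f (spectrum ℝ D) := fun f => continuousOn_spectrum f D
  refine ⟨cfc s D, ?_, ?_⟩
  · rw [hs, ← cfc_mul s s D (hcont _) (hcont _), ← cfc_const_one ℝ D]
    refine congrArg (fun f => cfc f D) (funext fun x => ?_)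
    simp only [s]
    split_ifs <;> norm_num
  · have h1 : Dᴴ * D = cfc (fun x : ℝ => x * x) D := by
      rw [← mul_cfc hD, cfc_id' ℝ D, hD.eq]
    have h2 : cfc s D * D = cfc (fun x => s x * x) D := by
      rw [cfc_mul s (fun x => x) D (hcont _) (hcont _), cfc_id' ℝ D]
    rw [traceNorm, h1, h2, ← cfc_comp' Real.sqrt (fun x : ℝ => x * x) D
      Real.continuous_sqrt.continuousOn (hcont _)]
    refine congrArg (fun f => (cfc f D).trace.re) (funext fun x => ?_)
    simp only [s]
    split_ifs with hx
    · rw [Real.sqrt_mul_self hx, one_mul]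
    · rw [Real.sqrt_mul_self_eq_abs, abs_of_neg (not_le.mp hx), neg_one_mul]

/-! ### Positivity and the matrix exponential -/

section
variable {n : Type*} [Fintype n] [DecidableEq n]

lemma posSemidef_cfc {A : Matrix n n ℂ} (hA : A.IsHermitian) {f : ℝ → ℝ}
    (hf : ∀ i, 0 ≤ f (hA.eigenvalues i)) : (cfc f A).PosSemidef := by
  rw [cfc_eq_mul_diagonal_mul hA]
  exact (Matrix.PosSemidef.diagonal fun i => by simpa using hf i).mul_mul_conjTranspose_same _

lemma posDef_cfc {A : Matrix n n ℂ} (hA : A.IsHermitian) {f : ℝ → ℝ}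
    (hf : ∀ i, 0 < f (hA.eigenvalues i)) : (cfc f A).PosDef := by
  refine (posSemidef_cfc hA fun i => (hf i).le).posDef_iff_det_ne_zero.mpr ?_
  rw [cfc_eq_mul_diagonal_mul hA, Matrix.det_mul_right_comm, eigenvectorUnitary_mul_conjTranspose,
    Matrix.one_mul, Matrix.det_diagonal]
  exact Finset.prod_ne_zero_iff.mpr fun i _ => Complex.ofReal_ne_zero.mpr (hf i).ne'

lemma exists_pos_le_eigenvalues {A : Matrix n n ℂ} (hA : A.PosDef) :
    ∃ c > 0, ∀ i, c ≤ hA.1.eigenvalues i := by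
  rcases isEmpty_or_nonempty n with h | h
  · exact ⟨1, one_pos, fun i => h.elim i⟩
  · obtain ⟨i, hi⟩ := Finite.exists_min hA.1.eigenvalues
    exact ⟨_, hA.eigenvalues_pos i, hi⟩

lemma posSemidef_sub_smul_one {A : Matrix n n ℂ} (hA : A.IsHermitian) {c : ℝ}
    (hc : ∀ i, c ≤ hA.eigenvalues i) : (A - c • (1 : Matrix n n ℂ)).PosSemidef := by
  have hA' : IsSelfAdjoint A := hA
  have h := posSemidef_cfc hA (f := fun x => x - c) fun i => sub_nonneg.mpr (hc i)
  rwa [cfc_sub (fun x => x) (fun _ => c) A (continuousOn_spectrum _ _) (continuousOn_spectrum _ _),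
    cfc_id' ℝ A, cfc_const c A, Algebra.algebraMap_eq_smul_one] at h

/-- A positive definite matrix can be moved a little in any Hermitian direction. -/
lemma exists_forall_posSemidef_add_smul {A D : Matrix n n ℂ} (hA : A.PosDef)
    (hD : D.IsHermitian) : ∃ ε > 0, ∀ t : ℝ, 0 ≤ t → t ≤ ε → (A + t • D).PosSemidef := by
  obtain ⟨δ, hδ, hδA⟩ := exists_pos_le_eigenvalues hA
  set c : ℝ := 1 + ∑ i, |hD.eigenvalues i| with hc
  have hc0 : 0 < c := by
    have : 0 ≤ ∑ i, |hD.eigenvalues i| := Finset.sum_nonneg fun i _ => abs_nonneg _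
    linarith
  have hcD : ∀ i, -c ≤ hD.eigenvalues i := by
    intro i
    have h1 : |hD.eigenvalues i| ≤ ∑ i, |hD.eigenvalues i| :=
      Finset.single_le_sum (f := fun i => |hD.eigenvalues i|) (fun i _ => abs_nonneg _)
        (Finset.mem_univ i)
    linarith [neg_abs_le (hD.eigenvalues i)]
  refine ⟨δ / c, div_pos hδ hc0, fun t ht0 ht => ?_⟩
  have h1 : A + t • D = (A - δ • (1 : Matrix n n ℂ)) + t • (D - (-c) • (1 : Matrix n n ℂ)) +
      (δ - t * c) • (1 : Matrix n n ℂ) := by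
    module
  rw [h1]
  exact ((posSemidef_sub_smul_one hA.1 hδA).add ((posSemidef_sub_smul_one hD hcD).smul ht0)).add
    (Matrix.PosSemidef.one.smul (sub_nonneg.mpr ((le_div_iff₀ hc0).mp ht)))

open scoped Matrix.Norms.L2Operator in
lemma exp_eq_cfc {K : Matrix n n ℂ} (hK : K.IsHermitian) : NormedSpace.exp K = cfc Real.exp K :=
  (CFC.real_exp_eq_normedSpace_exp hK.isSelfAdjoint).symm

end

/-! ### Entropy maximizers -/

theorem exists_lineMap_mem_of_mem_intrinsicInterior {E : Type*} [NormedAddCommGroup E]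
    [NormedSpace ℝ E] {s : Set E} {x y : E} (hx : x ∈ intrinsicInterior ℝ s) (hy : y ∈ s) :
    ∃ r : ℝ, 1 < r ∧ AffineMap.lineMap y x r ∈ s := by
  obtain ⟨z, hz, rfl⟩ := mem_intrinsicInterior.mp hx
  let f : ℝ → affineSpan ℝ s := fun r =>
    ⟨AffineMap.lineMap y (z : E) r, AffineMap.lineMap_mem r (subset_affineSpan ℝ s hy) z.2⟩
  have hf : Continuous f := AffineMap.lineMap_continuous.subtype_mk _
  have hf1 : f 1 = z := Subtype.ext (AffineMap.lineMap_apply_one _ _)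
  have h := hf.continuousAt.preimage_mem_nhds (x := 1)
    (by rw [hf1]; exact mem_interior_iff_mem_nhds.mp hz)
  obtain ⟨r, hr, hr1⟩ := Filter.nonempty_of_mem (Filter.inter_mem
    (mem_nhdsWithin_of_mem_nhds h) (self_mem_nhdsWithin : Set.Ioi (1 : ℝ) ∈ nhdsWithin 1 _))
  exact ⟨r, hr1, hr⟩

section
variable {d k : ℕ} {X : Fin k → Matrix (Fin d) (Fin d) ℂ} {m : EuclideanSpace ℝ (Fin k)}
  {ρ σ : Matrix (Fin d) (Fin d) ℂ}

lemma relEntropy_eq (A B : Matrix (Fin d) (Fin d) ℂ) :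
    relEntropy A B = -entropy A - (A * cfc Real.log B).trace.re := by
  rw [relEntropy, entropy, neg_neg]

/-- Quantum Pinsker inequality. -/
theorem traceNorm_sub_le_sqrt_relEntropy (hρ : ρ ∈ stateSpace d) (hσ : σ ∈ stateSpace d)
    (hker : ∀ v, σ *ᵥ v = 0 → ρ *ᵥ v = 0) : traceNorm (ρ - σ) ≤ √(2 * relEntropy ρ σ) := by
  obtain ⟨U, hU, hUt⟩ := exists_traceNorm_eq (hρ.1.1.sub hσ.1.1)
  rw [hUt]
  exact Real.le_sqrt_of_sq_le (sq_re_trace_mul_sub_le hρ.1 hσ.1 hρ.2 hσ.2 hker hU)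

lemma re_trace_smul_mul (t : ℝ) (A B : Matrix (Fin d) (Fin d) ℂ) :
    ((t • A) * B).trace.re = t * (A * B).trace.re := by
  rw [Matrix.smul_mul, Matrix.trace_smul, Complex.smul_re, smul_eq_mul]

lemma convex_stateSpace : Convex ℝ (stateSpace d) := by
  intro ρ hρ σ hσ a b ha hb hab
  refine ⟨(hρ.1.smul ha).add (hσ.1.smul hb), ?_⟩
  rw [Matrix.trace_add, Matrix.trace_smul, Matrix.trace_smul, hρ.2, hσ.2, ← add_smul, hab, one_smul]

lemma convex_constraintSet : Convex ℝ (constraintSet X m) := by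
  intro ρ hρ σ hσ a b ha hb hab
  refine ⟨convex_stateSpace hρ.1 hσ.1 ha hb hab, fun i => ?_⟩
  rw [Matrix.add_mul, Matrix.smul_mul, Matrix.smul_mul, Matrix.trace_add, Matrix.trace_smul,
    Matrix.trace_smul, hρ.2, hσ.2, ← add_smul, hab, one_smul]

lemma mem_constraintSet_iff (hX : ∀ i, (X i).IsHermitian) :
    ρ ∈ constraintSet X m ↔ ρ ∈ stateSpace d ∧ moments X ρ = m := by
  refine and_congr_right fun hρ => ?_
  rw [PiLp.ext_iff]
  refine forall_congr' fun i => ?_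
  rw [← ofReal_re_trace_mul hρ.1.1 (hX i), Complex.ofReal_inj]
  rfl

/-- With `ρₜ = (1 - t) σ + t ρ`, one has the identity
`(1 - t) D(σ‖ρₜ) + t D(ρ‖ρₜ) = S(ρₜ) - (1 - t) S(σ) - t S(ρ)`; here `S(ρₜ) ≤ S(σ)` and
`D(σ‖ρₜ) ≥ 0`. The mixture `ρₜ` takes the place of `σ`, whose kernel need not lie in that of `ρ`. -/
theorem relEntropy_le_of_isEntropyMaximizer (hσ : IsEntropyMaximizer X m σ)
    (hρ : ρ ∈ constraintSet X m) {t : ℝ} (ht0 : 0 < t) (ht1 : t < 1) :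
    relEntropy ρ ((1 - t) • σ + t • ρ) ≤ entropy σ - entropy ρ := by
  set τ := (1 - t) • σ + t • ρ with hτ
  have hs0 : 0 < 1 - t := sub_pos.mpr ht1
  have hτC : τ ∈ constraintSet X m := convex_constraintSet hσ.1 hρ hs0.le ht0.le (by ring)
  have hker : ∀ v, τ *ᵥ v = 0 → σ *ᵥ v = 0 := by
    intro v hv
    rw [hτ, add_comm] at hv
    have h := mulVec_eq_zero_of_add (hρ.1.1.smul ht0.le) (hσ.1.1.1.smul hs0.le) hv
    rw [Matrix.smul_mulVec] at h
    exact (smul_eq_zero.mp h).resolve_left hs0.ne'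
  have h1 := relEntropy_nonneg hσ.1.1.1 hτC.1.1 (hσ.1.1.2.trans hτC.1.2.symm) hker
  have h2 := hσ.2 τ hτC
  have h3 : entropy τ =
      -((1 - t) * (σ * cfc Real.log τ).trace.re + t * (ρ * cfc Real.log τ).trace.re) := by
    rw [entropy]
    conv_lhs => enter [1, 1, 1, 1]; rw [hτ]
    rw [Matrix.add_mul, Matrix.trace_add, Complex.add_re, re_trace_smul_mul, re_trace_smul_mul]
  rw [relEntropy_eq] at h1 ⊢
  have h4 := mul_nonneg hs0.le h1
  have h5 : t * (-(ρ * cfc Real.log τ).trace.re) ≤ t * entropy σ := by linarith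
  have h6 := le_of_mul_le_mul_left h5 ht0
  linarith

/-- Pinsker's inequality for `ρ` and the mixture `(1 - t) σ + t ρ`, in the limit `t → 0`. -/
theorem traceNorm_sub_le_of_isEntropyMaximizer (hσ : IsEntropyMaximizer X m σ)
    (hρ : ρ ∈ constraintSet X m) :
    traceNorm (ρ - σ) ≤ √(2 * (entropy σ - entropy ρ)) := by
  obtain ⟨U, hU, hUt⟩ := exists_traceNorm_eq (hρ.1.1.1.sub hσ.1.1.1.1)
  rw [hUt]
  set T := (U * (ρ - σ)).trace.re
  refine Real.le_sqrt_of_sq_le ?_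
  have hlim : Filter.Tendsto (fun t : ℝ => ((1 - t) * T) ^ 2) (nhdsWithin 0 (Set.Ioi 0))
      (nhds (T ^ 2)) := by
    have : Continuous fun t : ℝ => ((1 - t) * T) ^ 2 := by fun_prop
    have h := this.tendsto 0
    simp only [sub_zero, one_mul] at h
    exact h.mono_left nhdsWithin_le_nhds
  refine le_of_tendsto hlim ?_
  filter_upwards [Ioo_mem_nhdsGT (zero_lt_one' ℝ)] with t ht
  have hs0 : 0 < 1 - t := sub_pos.mpr ht.2
  have hτ := convex_constraintSet hσ.1 hρ hs0.le ht.1.le (by ring)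
  have hker : ∀ v, ((1 - t) • σ + t • ρ) *ᵥ v = 0 → ρ *ᵥ v = 0 := by
    intro v hv
    have h := mulVec_eq_zero_of_add (hσ.1.1.1.smul hs0.le) (hρ.1.1.smul ht.1.le) hv
    rw [Matrix.smul_mulVec] at h
    exact (smul_eq_zero.mp h).resolve_left ht.1.ne'
  have h1 := sq_re_trace_mul_sub_le hρ.1.1 hτ.1.1 hρ.1.2 hτ.1.2 hker hU
  have h2 : ρ - ((1 - t) • σ + t • ρ) = (1 - t) • (ρ - σ) := by module
  rw [h2, Matrix.mul_smul, Matrix.trace_smul, Complex.smul_re, smul_eq_mul] at h1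
  exact h1.trans (mul_le_mul_of_nonneg_left
    (relEntropy_le_of_isEntropyMaximizer hσ hρ ht.1 ht.2) zero_le_two)

/-- A relative interior point of the moment set is a proper mixture of the moments of the maximally
mixed state and those of another state, hence the moment vector of a positive definite state. -/
theorem exists_posDef_mem_constraintSet (hX : ∀ i, (X i).IsHermitian) (hd : 0 < d)
    (hm : m ∈ intrinsicInterior ℝ (momentSet X)) : ∃ τ ∈ constraintSet X m, τ.PosDef := by
  have hd' : (0 : ℝ) < (d : ℝ)⁻¹ := by positivity
  set ω : Matrix (Fin d) (Fin d) ℂ := (d : ℝ)⁻¹ • 1 with hω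
  have hωpos : ω.PosDef := Matrix.PosDef.one.smul hd'
  have hωst : ω ∈ stateSpace d := by
    refine ⟨hωpos.posSemidef, ?_⟩
    rw [hω, Matrix.trace_smul, Matrix.trace_one, Fintype.card_fin, Complex.real_smul]
    push_cast
    exact inv_mul_cancel₀ (Nat.cast_ne_zero.mpr hd.ne')
  -- Extend the segment from the moments of `ω` slightly beyond `m`.
  obtain ⟨r, hr, ρ, hρ, hρm⟩ :=
    exists_lineMap_mem_of_mem_intrinsicInterior hm (Set.mem_image_of_mem (moments X) hωst)
  have hr0 : 0 < r := one_pos.trans hr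
  have h0 : 0 < 1 - r⁻¹ := sub_pos.mpr (inv_lt_one_of_one_lt₀ hr)
  refine ⟨r⁻¹ • ρ + (1 - r⁻¹) • ω, (mem_constraintSet_iff hX).mpr
    ⟨convex_stateSpace hρ hωst (inv_pos.mpr hr0).le h0.le (by ring), ?_⟩,
    Matrix.PosDef.posSemidef_add (hρ.1.smul (inv_pos.mpr hr0).le) (hωpos.smul h0)⟩
  ext i
  have h1 : (moments X ρ) i = (moments X ω) i + r * (m i - (moments X ω) i) := by
    rw [hρm, AffineMap.lineMap_apply]
    simp
    ring
  change ((r⁻¹ • ρ + (1 - r⁻¹) • ω) * X i).trace.re = m i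
  rw [Matrix.add_mul, Matrix.trace_add, Complex.add_re, re_trace_smul_mul, re_trace_smul_mul]
  change r⁻¹ * (moments X ρ) i + (1 - r⁻¹) * (moments X ω) i = m i
  rw [h1]
  field_simp
  ring

/-- The entropy has infinite slope at singular states: by `relEntropy_le_of_isEntropyMaximizer`, the
determinants of `(1 - t) σ + t τ` stay above a positive constant as `t → 0`. -/
theorem posDef_of_isEntropyMaximizer (hσ : IsEntropyMaximizer X m σ)
    {τ : Matrix (Fin d) (Fin d) ℂ} (hτ : τ ∈ constraintSet X m) (hτpos : τ.PosDef) :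
    σ.PosDef := by
  obtain ⟨c, hc, hcτ⟩ := exists_pos_le_eigenvalues hτpos
  have hlim : Filter.Tendsto (fun t : ℝ => ((1 - t) • σ + t • τ).det.re) (nhdsWithin 0 (Set.Ioi 0))
      (nhds σ.det.re) := by
    have : Continuous fun t : ℝ => ((1 - t) • σ + t • τ).det.re :=
      Complex.continuous_re.comp (Continuous.matrix_det (by fun_prop))
    have h := this.tendsto 0
    simp only [sub_zero, one_smul, zero_smul, add_zero] at h
    exact h.mono_left nhdsWithin_le_nhds
  have hdet : Real.exp (-entropy σ / c) ≤ σ.det.re := by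
    refine ge_of_tendsto hlim ?_
    filter_upwards [Ioo_mem_nhdsGT (zero_lt_one' ℝ)] with t ht
    have hs0 : 0 < 1 - t := sub_pos.mpr ht.2
    have hC := convex_constraintSet hσ.1 hτ hs0.le ht.1.le (by ring)
    have hpos : ((1 - t) • σ + t • τ).PosDef :=
      Matrix.PosDef.posSemidef_add (hσ.1.1.1.smul hs0.le) (hτpos.smul ht.1)
    have h1 := relEntropy_le_of_isEntropyMaximizer hσ hτ ht.1 ht.2
    have h2 := re_trace_mul_log_le_mul_log_det hτpos.1 hpos hC.1.2 hcτ
    rw [relEntropy_eq] at h1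
    rw [← Real.le_log_iff_exp_le (Complex.pos_iff.mp hpos.det_pos).1, div_le_iff₀ hc, mul_comm]
    linarith
  refine hσ.1.1.1.posDef_iff_det_ne_zero.mpr fun h => ?_
  rw [h, Complex.zero_re] at hdet
  exact absurd hdet (not_le.mpr (Real.exp_pos _))

end

/-! ### Gibbs states and multipliers -/

section
variable {d k : ℕ} {X : Fin k → Matrix (Fin d) (Fin d) ℂ} {m : EuclideanSpace ℝ (Fin k)}
  {ρ σ : Matrix (Fin d) (Fin d) ℂ}

lemma isHermitian_sum_smul {ι : Type*} [Fintype ι] {Y : ι → Matrix (Fin d) (Fin d) ℂ}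
    (hY : ∀ i, (Y i).IsHermitian) (l : ι → ℝ) : (∑ i, l i • Y i).IsHermitian :=
  isSelfAdjoint_sum _ fun i _ => IsSelfAdjoint.smul (IsSelfAdjoint.all _) (hY i)

theorem gibbsState_eq_of_log_eq (hσ : σ.PosDef) (htr : σ.trace = 1)
    {l : EuclideanSpace ℝ (Fin k)} {c : ℝ}
    (h : cfc Real.log σ = c • (1 : Matrix (Fin d) (Fin d) ℂ) - ∑ i, l i • X i) :
    σ = gibbsState X l := by
  have hσ' : IsSelfAdjoint σ := hσ.1
  have hcont : ∀ f : ℝ → ℝ, ContinuousOn f (spectrum ℝ σ) := fun f => continuousOn_spectrum f σ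
  have h1 : -∑ i, l i • X i = cfc (fun x => Real.log x - c) σ := by
    rw [cfc_sub Real.log (fun _ => c) σ (hcont _) (hcont _), h, cfc_const c σ,
      Algebra.algebraMap_eq_smul_one]
    abel
  have h2 : NormedSpace.exp (-∑ i, l i • X i) = Real.exp (-c) • σ := by
    rw [h1, exp_eq_cfc (cfc_predicate _ σ : IsSelfAdjoint _), ← cfc_comp' Real.exp _ σ
      Real.continuous_exp.continuousOn (hcont _)]
    nth_rw 2 [← cfc_id' ℝ σ]
    rw [← cfc_smul (Real.exp (-c)) (fun x => x) σ (hcont _)]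
    refine cfc_congr fun x hx => ?_
    obtain ⟨i, rfl⟩ := hσ.1.spectrum_real_eq_range_eigenvalues ▸ hx
    simp only [smul_eq_mul]
    rw [sub_eq_add_neg, Real.exp_add, Real.exp_log (hσ.eigenvalues_pos i), mul_comm]
  rw [gibbsState, h2, Matrix.trace_smul, htr, Complex.real_smul, mul_one, ← Complex.ofReal_inv,
    Complex.coe_smul, smul_smul, inv_mul_cancel₀ (Real.exp_pos _).ne', one_smul]

/-- The trace hypothesis excludes dimension zero, where the partition function vanishes and its
inverse is the junk value `0`. -/
theorem posDef_gibbsState_and_log_eq (hX : ∀ i, (X i).IsHermitian) {l : EuclideanSpace ℝ (Fin k)}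
    (htr : (gibbsState X l).trace = 1) :
    (gibbsState X l).PosDef ∧ ∃ c : ℝ, cfc Real.log (gibbsState X l) =
      c • (1 : Matrix (Fin d) (Fin d) ℂ) - ∑ i, l i • X i := by
  set K := -∑ i, l i • X i with hK
  have hKh : K.IsHermitian := (isHermitian_sum_smul hX l).neg
  have hK' : IsSelfAdjoint K := hKh
  have hcont : ∀ f : ℝ → ℝ, ContinuousOn f (spectrum ℝ K) := fun f => continuousOn_spectrum f K
  have hE : (cfc Real.exp K).PosDef := posDef_cfc hKh fun i => Real.exp_pos _
  obtain ⟨hre, him⟩ := Complex.nonneg_iff.mp hE.posSemidef.trace_nonneg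
  set z := (cfc Real.exp K).trace.re with hz
  have hzz : (cfc Real.exp K).trace = z := Complex.ext rfl him.symm
  have hg : gibbsState X l = z⁻¹ • cfc Real.exp K := by
    rw [gibbsState, ← hK, exp_eq_cfc hKh, hzz, ← Complex.ofReal_inv, Complex.coe_smul]
  have hz0 : 0 < z := by
    refine hre.lt_of_ne fun h0 => ?_
    rw [hg, ← h0, inv_zero, zero_smul, Matrix.trace_zero] at htr
    exact zero_ne_one htr
  refine ⟨hg ▸ hE.smul (inv_pos.mpr hz0), Real.log z⁻¹, ?_⟩
  rw [hg, ← cfc_smul z⁻¹ Real.exp K (hcont _), ← cfc_comp' Real.log _ K ?_ (hcont _)]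
  · have h1 : cfc (fun x => Real.log (z⁻¹ • Real.exp x)) K =
        cfc (fun x => Real.log z⁻¹ + x) K := by
      refine cfc_congr fun x _ => ?_
      simp only [smul_eq_mul]
      rw [Real.log_mul (inv_pos.mpr hz0).ne' (Real.exp_pos x).ne', Real.log_exp]
    rw [h1, cfc_const_add _ (fun x => x) K (hcont _), cfc_id' ℝ K, Algebra.algebraMap_eq_smul_one,
      hK, sub_eq_add_neg]
  · refine Real.continuousOn_log.mono ?_
    rintro _ ⟨x, -, rfl⟩
    exact (mul_pos (inv_pos.mpr hz0) (Real.exp_pos x)).ne'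

/-- First-order condition at a positive definite maximizer: `log σ` is orthogonal to the Hermitian
directions that preserve the constraints. -/
theorem re_trace_mul_log_eq_zero (hσ : IsEntropyMaximizer X m σ) (hpos : σ.PosDef)
    {D : Matrix (Fin d) (Fin d) ℂ} (hD : D.IsHermitian) (hD0 : D.trace = 0)
    (hDX : ∀ i, (D * X i).trace = 0) : (D * cfc Real.log σ).trace.re = 0 := by
  have key : ∀ D : Matrix (Fin d) (Fin d) ℂ, D.IsHermitian → D.trace = 0 →
      (∀ i, (D * X i).trace = 0) → 0 ≤ (D * cfc Real.log σ).trace.re := by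
    intro D hD hD0 hDX
    obtain ⟨C, hC⟩ := exists_relEntropy_le hpos
    obtain ⟨ε, hε, hpsd⟩ := exists_forall_posSemidef_add_smul hpos hD
    set q := C * (D * D).trace.re with hq
    have hlim : Filter.Tendsto (fun t : ℝ => -(q * t)) (nhdsWithin 0 (Set.Ioi 0)) (nhds 0) := by
      have : Continuous fun t : ℝ => -(q * t) := by fun_prop
      have h := this.tendsto 0
      simp only [mul_zero, neg_zero] at h
      exact h.mono_left nhdsWithin_le_nhds
    refine le_of_tendsto hlim ?_
    filter_upwards [Ioo_mem_nhdsGT hε] with t ht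
    have htr : (σ + t • D).trace = σ.trace := by
      rw [Matrix.trace_add, Matrix.trace_smul, hD0, smul_zero, add_zero]
    have hmem : σ + t • D ∈ constraintSet X m := by
      refine ⟨⟨hpsd t ht.1.le ht.2.le, htr.trans hσ.1.1.2⟩, fun i => ?_⟩
      rw [Matrix.add_mul, Matrix.trace_add, Matrix.smul_mul, Matrix.trace_smul, hDX, smul_zero,
        add_zero, hσ.1.2]
    have h1 := hC _ hmem.1.1 htr
    have h2 := hσ.2 _ hmem
    have h3 : entropy σ = -(σ * cfc Real.log σ).trace.re := rfl
    rw [add_sub_cancel_left, relEntropy_eq, Matrix.add_mul, Matrix.trace_add, Complex.add_re,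
      re_trace_smul_mul, re_trace_smul_mul, Matrix.mul_smul, Matrix.trace_smul, Complex.smul_re,
      smul_eq_mul] at h1
    -- `-t tr (D log σ) ≤ D(σ + t D‖σ) ≤ q t²`, as `S(σ + t D) ≤ S(σ)`.
    have h4 : t * -(q * t) ≤ t * (D * cfc Real.log σ).trace.re := by
      rw [hq]
      linarith
    exact le_of_mul_le_mul_left h4 ht.1
  refine le_antisymm ?_ (key D hD hD0 hDX)
  have h := key (-D) hD.neg (by rw [Matrix.trace_neg, hD0, neg_zero]) fun i => by
    rw [Matrix.neg_mul, Matrix.trace_neg, hDX, neg_zero]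
  rw [Matrix.neg_mul, Matrix.trace_neg, Complex.neg_re] at h
  linarith

/-- Finite-dimensional duality on Hermitian matrices with the trace pairing: a Hermitian matrix that
is orthogonal to everything orthogonal to the Hermitian `Yᵢ` is a real combination of them. -/
theorem exists_eq_sum_smul_of_trace_orthogonal {ι : Type*} [Fintype ι]
    {Y : ι → Matrix (Fin d) (Fin d) ℂ} (hY : ∀ i, (Y i).IsHermitian)
    {L : Matrix (Fin d) (Fin d) ℂ} (hL : L.IsHermitian)
    (h : ∀ D : Matrix (Fin d) (Fin d) ℂ, D.IsHermitian → (∀ i, (D * Y i).trace = 0) →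
      (D * L).trace.re = 0) : ∃ c : ι → ℝ, L = ∑ i, c i • Y i := by
  let φ : Matrix (Fin d) (Fin d) ℂ → selfAdjoint (Matrix (Fin d) (Fin d) ℂ) →ₗ[ℝ] ℝ := fun B =>
    { toFun := fun D => ((D : Matrix (Fin d) (Fin d) ℂ) * B).trace.re
      map_add' := fun D D' => by
        simp only [AddSubgroup.coe_add, Matrix.add_mul, Matrix.trace_add, Complex.add_re]
      map_smul' := fun t D => by
        simp only [selfAdjoint.val_smul, re_trace_smul_mul, RingHom.id_apply, smul_eq_mul] }
  have hφ : φ L ∈ Submodule.span ℝ (Set.range fun i => φ (Y i)) := by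
    refine mem_span_of_iInf_ker_le_ker fun D hD => ?_
    rw [Submodule.mem_iInf] at hD
    refine LinearMap.mem_ker.mpr (h D D.2 fun i => ?_)
    rw [← ofReal_re_trace_mul D.2 (hY i), Complex.ofReal_eq_zero]
    exact LinearMap.mem_ker.mp (hD i)
  obtain ⟨c, hc⟩ := (Submodule.mem_span_range_iff_exists_fun ℝ).mp hφ
  refine ⟨c, ?_⟩
  set H := L - ∑ i, c i • Y i with hH
  have hHh : H.IsHermitian := hL.sub (isHermitian_sum_smul hY c)
  have h1 := LinearMap.congr_fun hc ⟨H, hHh⟩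
  simp only [LinearMap.coe_sum, Finset.sum_apply, LinearMap.smul_apply, smul_eq_mul] at h1
  have h2 : (H * H).trace.re = 0 := by
    conv_lhs => enter [1, 1, 2]; rw [hH]
    rw [Matrix.mul_sub, Matrix.trace_sub, Complex.sub_re, sub_eq_zero, Matrix.mul_sum,
      Matrix.trace_sum, Complex.re_sum]
    refine h1.symm.trans (Finset.sum_congr rfl fun i _ => ?_)
    rw [Matrix.mul_smul, Matrix.trace_smul, Complex.smul_re, smul_eq_mul]
    rfl
  have h3 : (Hᴴ * H).trace = 0 := by
    rw [hHh.eq, ← ofReal_re_trace_mul hHh hHh, h2, Complex.ofReal_zero]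
  exact sub_eq_zero.mp (Matrix.trace_conjTranspose_mul_self_eq_zero_iff.mp h3)

theorem exists_eq_gibbsState (hX : ∀ i, (X i).IsHermitian) (hσ : IsEntropyMaximizer X m σ)
    (hpos : σ.PosDef) : ∃ l : EuclideanSpace ℝ (Fin k), σ = gibbsState X l := by
  -- The identity matrix, at `none`, is the multiplier of the constraint `tr ρ = 1`.
  obtain ⟨c, hc⟩ := exists_eq_sum_smul_of_trace_orthogonal (ι := Option (Fin k))
    (Y := fun o => o.elim 1 X) (L := cfc Real.log σ)
    (fun o => by cases o with
      | none => exact Matrix.isHermitian_one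
      | some i => exact hX i)
    (cfc_predicate _ σ : IsSelfAdjoint _)
    (fun D hD h => re_trace_mul_log_eq_zero hσ hpos hD (by simpa using h none)
      fun i => h (some i))
  refine ⟨WithLp.toLp 2 fun i => -c (some i), gibbsState_eq_of_log_eq hpos hσ.1.1.2
    (c := c none) ?_⟩
  rw [hc, Fintype.sum_option]
  simp

/-- Relative entropy to a Gibbs state: entropy difference plus a term linear in the moments. -/
theorem relEntropy_gibbsState (hX : ∀ i, (X i).IsHermitian) {l : EuclideanSpace ℝ (Fin k)}
    (hσ : gibbsState X l ∈ stateSpace d) (hρ : ρ ∈ stateSpace d) :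
    relEntropy ρ (gibbsState X l) = entropy (gibbsState X l) - entropy ρ +
      inner ℝ l (moments X ρ - moments X (gibbsState X l)) := by
  obtain ⟨-, c, hc⟩ := posDef_gibbsState_and_log_eq hX hσ.2
  have h1 : ∀ τ ∈ stateSpace d, (τ * cfc Real.log (gibbsState X l)).trace.re =
      c - inner ℝ l (moments X τ) := by
    intro τ hτ
    rw [hc, Matrix.mul_sub, Matrix.mul_smul, Matrix.mul_one, Matrix.trace_sub, Matrix.trace_smul,
      hτ.2, Matrix.mul_sum, Matrix.trace_sum, Complex.sub_re, Complex.smul_re, Complex.one_re,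
      smul_eq_mul, mul_one, Complex.re_sum, PiLp.inner_apply]
    congr 1
    refine Finset.sum_congr rfl fun i _ => ?_
    rw [Matrix.mul_smul, Matrix.trace_smul, Complex.smul_re, smul_eq_mul, real_inner_comm]
    rfl
  rw [relEntropy_eq, h1 ρ hρ, inner_sub_right]
  have h2 : entropy (gibbsState X l) =
    -(gibbsState X l * cfc Real.log (gibbsState X l)).trace.re := rfl
  rw [h2, h1 _ hσ]
  ring

theorem traceNorm_sub_gibbsState_le (hX : ∀ i, (X i).IsHermitian)
    {l : EuclideanSpace ℝ (Fin k)} (hσ : gibbsState X l ∈ stateSpace d)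
    (hρ : ρ ∈ stateSpace d) :
    traceNorm (ρ - gibbsState X l) ≤ √(2 * |entropy (gibbsState X l) - entropy ρ|) +
      √(2 * ‖l‖ * ‖moments X ρ - moments X (gibbsState X l)‖) := by
  have hpos := (posDef_gibbsState_and_log_eq hX hσ.2).1
  have hker : ∀ v, gibbsState X l *ᵥ v = 0 → ρ *ᵥ v = 0 := by
    intro v hv
    rw [Matrix.eq_zero_of_mulVec_eq_zero hpos.det_pos.ne' hv, Matrix.mulVec_zero]
  refine (traceNorm_sub_le_sqrt_relEntropy hρ hσ hker).trans ((Real.sqrt_le_sqrt ?_).trans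
    (sqrt_add_le (by positivity) (by positivity)))
  rw [relEntropy_gibbsState hX hσ hρ]
  have h1 := real_inner_le_norm l (moments X ρ - moments X (gibbsState X l))
  have h2 := le_abs_self (entropy (gibbsState X l) - entropy ρ)
  linarith

end

end MaxEnt

theorem proposition4p2 (d k : ℕ) (X : Fin k → Matrix (Fin d) (Fin d) ℂ)
    (hX : ∀ i, (X i).IsHermitian) (m : EuclideanSpace ℝ (Fin k))
    (σ : Matrix (Fin d) (Fin d) ℂ) (hσ : MaxEnt.IsEntropyMaximizer X m σ) :
    (∀ ρ ∈ MaxEnt.constraintSet X m,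
      MaxEnt.traceNorm (ρ - σ) ≤ √(2 * (MaxEnt.entropy σ - MaxEnt.entropy ρ))) ∧
    (m ∈ intrinsicInterior ℝ (MaxEnt.momentSet X) →
      (∃ l : EuclideanSpace ℝ (Fin k), σ = MaxEnt.gibbsState X l) ∧
      ∀ l : EuclideanSpace ℝ (Fin k), σ = MaxEnt.gibbsState X l →
        ∀ ρ ∈ MaxEnt.stateSpace d,
          MaxEnt.traceNorm (ρ - σ) ≤
            √(2 * |MaxEnt.entropy σ - MaxEnt.entropy ρ|) +
              √(2 * ‖l‖ * ‖MaxEnt.moments X ρ - m‖)) := by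
  refine ⟨fun ρ hρ => MaxEnt.traceNorm_sub_le_of_isEntropyMaximizer hσ hρ, fun hm => ⟨?_, ?_⟩⟩
  · have hd : 0 < d := by
      rcases Nat.eq_zero_or_pos d with rfl | h
      · have h := hσ.1.1.2
        rw [Matrix.trace_fin_zero] at h
        exact absurd h zero_ne_one
      · exact h
    obtain ⟨τ, hτ, hτpos⟩ := MaxEnt.exists_posDef_mem_constraintSet hX hd hm
    exact MaxEnt.exists_eq_gibbsState hX hσ (MaxEnt.posDef_of_isEntropyMaximizer hσ hτ hτpos)
  · rintro l rfl ρ hρ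
    have h := MaxEnt.traceNorm_sub_gibbsState_le hX hσ.1.1 hρ
    rwa [((MaxEnt.mem_constraintSet_iff hX).mp hσ.1).2] at h
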